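/- Setting (all quantum systems are finite-dimensional). In the bomb-and-prize game there are four boxes; a configuration is a pair $(b,x)$ with $b\in\{1,2,3,4\}$ the box containing the bomb and $x\in\{1,2,3,4\}\setminus\{b\}$ the box containing the prize. A protocol using a qubit channel $\mathcal N$ (from a qubit $Q$ to itself) consists of a bipartite state $\rho_{AB}$ of systems $A$, $B$ of arbitrary finite dimensions, shared by Alice and Bob; an encoding channel $\mathcal E_{b,x}$ from $A$ to $Q$ for every configuration $(b,x)$; and a POVM $(M_y)_{y\in\{1,2,3,4\}}$ on $Q\otimes B$, whose outcome $y$ is the box that Bob opens. The probability that Bob opens box $y$ is $$p(y|b,x)=\operatorname{Tr}\big[M_y\,(\mathcal N\mathcal E_{b,x}\otimes\mathcal I_B)(\rho_{AB})\big].$$ Put $p^{\rm bomb}_{\rm worst}=\max_{b,x}p(b|b,x)$ and $p^{\rm prize}_{\rm worst}=\min_{b,x}p(x|b,x)$, over all configurations. The protocol is bomb-avoiding if $p^{\rm bomb}_{\rm worst}=0$. A quantum NOT channel is a qubit channel of the form $\mathcal N=\sum_{j=1}^K q_j\,\mathcal N_j$ with $q_j>0$, $\sum_j q_j=1$ and $$\mathcal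 N_j(\rho)=|\psi^{(j)}_1\rangle\langle\psi^{(j)}_1|\,\langle\psi^{(j)}_0|\rho|\psi^{(j)}_0\rangle+|\psi^{(j)}_0\rangle\langle\psi^{(j)}_0|\,\langle\psi^{(j)}_1|\rho|\psi^{(j)}_1\rangle ,$$ where each $\{|\psi^{(j)}_0\rangle,|\psi^{(j)}_1\rangle\}$ is an orthonormal basis of $\mathbb C^2$, and at least two of these bases correspond to incompatible observables (some of their projectors do not commute). Theorem. (1) For every bomb-avoiding protocol using a quantum NOT channel, the shared state $\rho_{AB}$ is at least as entangled as one ebit: it can be converted, exactly and with certainty, by local operations and (finitely many rounds of) classical communication into the maximally entangled two-qubit state $|\Phi^+\rangle\langle\Phi^+|$, where $|\Phi^+\rangle=(|00\rangle+|11\rangle)/\sqrt2$. (2) Every bomb-avoiding protocol using a quantum NOT channel in which $A$ and $B$ are qubits satisfies $p^{\rm prize}_{\rm worst}\le 1/3$. -/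

import Mathlib

namespace BombPrize

open Matrix
open scoped ComplexOrder

/-- Square complex matrices with index set `α`: the operators `L(ℂ^α)` on a finite-dimensional
quantum system with computational basis `α`.  The composite of systems with index sets `α` and
`β` has index set `α × β`. -/
abbrev Op (α : Type) : Type := Matrix α α ℂ

/-- The rank-one operator `|v⟩⟨v|`. -/
def ketBra {α : Type} (v : α → ℂ) : Op α := vecMulVec v (star v)

/-- Density matrices: positive semidefinite operators of unit trace. -/
def IsDensity {α : Type} [Fintype α] (ρ : Op α) : Prop :=
  ρ.PosSemidef ∧ ρ.trace = 1

/-- The map `Φ ⊗ id`, acting with `Φ` on the first factor of a composite system. -/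
def onLeft {α α' : Type} (β : Type) (Φ : Op α →ₗ[ℂ] Op α') : Op (α × β) →ₗ[ℂ] Op (α' × β) where
  toFun X := Matrix.of fun p q => Φ (Matrix.of fun i j => X (i, p.2) (j, q.2)) p.1 q.1
  map_add' X Y := by
    ext p q
    exact congrFun (congrFun (map_add Φ (Matrix.of fun i j => X (i, p.2) (j, q.2))
      (Matrix.of fun i j => Y (i, p.2) (j, q.2))) p.1) q.1
  map_smul' c X := by
    ext p q
    exact congrFun (congrFun (map_smul Φ c (Matrix.of fun i j => X (i, p.2) (j, q.2))) p.1) q.1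

/-- The map `id ⊗ Φ`, acting with `Φ` on the second factor of a composite system. -/
def onRight {β β' : Type} (α : Type) (Φ : Op β →ₗ[ℂ] Op β') : Op (α × β) →ₗ[ℂ] Op (α × β') where
  toFun X := Matrix.of fun p q => Φ (Matrix.of fun k l => X (p.1, k) (q.1, l)) p.2 q.2
  map_add' X Y := by
    ext p q
    exact congrFun (congrFun (map_add Φ (Matrix.of fun k l => X (p.1, k) (q.1, l))
      (Matrix.of fun k l => Y (p.1, k) (q.1, l))) p.2) q.2
  map_smul' c X := by
    ext p q
    exact congrFun (congrFun (map_smul Φ c (Matrix.of fun k l => X (p.1, k) (q.1, l))) p.2) q.2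

/-- Complete positivity: `Φ ⊗ id` preserves positive semidefiniteness for every
finite-dimensional ancilla. -/
def IsCompletelyPositive {α α' : Type} [Fintype α] [Fintype α']
    (Φ : Op α →ₗ[ℂ] Op α') : Prop :=
  ∀ (k : ℕ) (X : Op (α × Fin k)), X.PosSemidef → (onLeft (Fin k) Φ X).PosSemidef

/-- Quantum channels: completely positive trace-preserving linear maps. -/
def IsChannel {α α' : Type} [Fintype α] [Fintype α'] (Φ : Op α →ₗ[ℂ] Op α') : Prop :=
  IsCompletelyPositive Φ ∧ ∀ X, (Φ X).trace = X.trace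

/-- Quantum instruments with outcomes in `Fin k`: completely positive maps, one for each outcome
(the output system may depend on the outcome), that jointly preserve the trace. -/
def IsInstrument {α : Type} [Fintype α] {k : ℕ} {d : Fin k → ℕ}
    (Φ : ∀ i : Fin k, Op α →ₗ[ℂ] Op (Fin (d i))) : Prop :=
  (∀ i, IsCompletelyPositive (Φ i)) ∧ ∀ X, ∑ i, (Φ i X).trace = X.trace

/-- Positive operator-valued measures with outcomes in `Fin n`. -/
def IsPOVM {α : Type} [Fintype α] [DecidableEq α] {n : ℕ} (M : Fin n → Op α) : Prop :=
  (∀ y, (M y).PosSemidef) ∧ ∑ y, M y = 1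

/-- `IsLOCC a' b' a b Λ`: the map `Λ`, from a bipartite system of dimensions `a`, `b` to a
bipartite system of dimensions `a'`, `b'`, is implemented by finitely many rounds of local
operations and classical communication.  A protocol either stops, or starts with a local
instrument of one of the two parties, whose outcome `i` is communicated to the other party,
after which the parties carry out an LOCC protocol that may depend on `i`. -/
inductive IsLOCC (a' b' : ℕ) :
    (a b : ℕ) → (Op (Fin a × Fin b) →ₗ[ℂ] Op (Fin a' × Fin b')) → Prop
  | halt : IsLOCC a' b' a' b' LinearMap.id
  | alice {a b k : ℕ} {d : Fin k → ℕ} (Φ : ∀ i : Fin k, Op (Fin a) →ₗ[ℂ] Op (Fin (d i)))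
      (hΦ : IsInstrument Φ)
      (Λ : ∀ i : Fin k, Op (Fin (d i) × Fin b) →ₗ[ℂ] Op (Fin a' × Fin b'))
      (hΛ : ∀ i, IsLOCC a' b' (d i) b (Λ i)) :
      IsLOCC a' b' a b (∑ i, Λ i ∘ₗ onLeft (Fin b) (Φ i))
  | bob {a b k : ℕ} {d : Fin k → ℕ} (Φ : ∀ i : Fin k, Op (Fin b) →ₗ[ℂ] Op (Fin (d i)))
      (hΦ : IsInstrument Φ)
      (Λ : ∀ i : Fin k, Op (Fin a × Fin (d i)) →ₗ[ℂ] Op (Fin a' × Fin b'))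
      (hΛ : ∀ i, IsLOCC a' b' a (d i) (Λ i)) :
      IsLOCC a' b' a b (∑ i, Λ i ∘ₗ onRight (Fin a) (Φ i))

/-- `ρ` can be converted (exactly and with certainty) into `σ` by LOCC. -/
def LOCCConvertible {a b a' b' : ℕ} (ρ : Op (Fin a × Fin b)) (σ : Op (Fin a' × Fin b')) : Prop :=
  ∃ Λ : Op (Fin a × Fin b) →ₗ[ℂ] Op (Fin a' × Fin b'), IsLOCC a' b' a b Λ ∧ Λ ρ = σ

/-- One ebit: the two-qubit state `|Φ⁺⟩⟨Φ⁺|` with `|Φ⁺⟩ = (|00⟩ + |11⟩)/√2`. -/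
noncomputable def ebit : Op (Fin 2 × Fin 2) :=
  ketBra fun p => if p.1 = p.2 then ((1 / √2 : ℝ) : ℂ) else 0

/-- Orthonormal bases of the qubit Hilbert space `ℂ²`. -/
abbrev QubitBasis : Type := OrthonormalBasis (Fin 2) ℂ (EuclideanSpace ℂ (Fin 2))

/-- The projector `|ψ_m⟩⟨ψ_m|` onto the `m`-th vector of the basis `ψ`. -/
noncomputable def basisProj (ψ : QubitBasis) (m : Fin 2) : Op (Fin 2) := ketBra (ψ m).ofLp

/-- The classical-to-quantum NOT channel of the basis `ψ`,
`ρ ↦ |ψ_1⟩⟨ψ_1| ⟨ψ_0|ρ|ψ_0⟩ + |ψ_0⟩⟨ψ_0| ⟨ψ_1|ρ|ψ_1⟩` (here `m + 1` is modulo `2`). -/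
noncomputable def cqNOT (ψ : QubitBasis) : Op (Fin 2) →ₗ[ℂ] Op (Fin 2) where
  toFun ρ := ∑ m : Fin 2, (star (ψ m).ofLp ⬝ᵥ (ρ *ᵥ (ψ m).ofLp)) • basisProj ψ (m + 1)
  map_add' ρ σ := by
    simp only [add_mulVec, dotProduct_add, add_smul, Finset.sum_add_distrib]
  map_smul' c ρ := by
    simp only [smul_mulVec, dotProduct_smul, smul_eq_mul, mul_smul, Finset.smul_sum,
      RingHom.id_apply]

/-- The projective measurements of two bases are incompatible: some of their projectors do not
commute. -/
def Incompatible (ψ φ : QubitBasis) : Prop :=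
  ∃ m n : Fin 2, ¬ Commute (basisProj ψ m) (basisProj φ n)

/-- Quantum NOT channels: random mixtures of classical-to-quantum NOT channels which contain, with
nonzero probabilities, at least two bases corresponding to incompatible observables. -/
def IsQuantumNOT (N : Op (Fin 2) →ₗ[ℂ] Op (Fin 2)) : Prop :=
  ∃ (K : ℕ) (q : Fin K → ℝ) (ψ : Fin K → QubitBasis),
    (∀ j, 0 < q j) ∧ ∑ j, q j = 1 ∧
    N = ∑ j, (q j : ℂ) • cqNOT (ψ j) ∧
    ∃ j₁ j₂ : Fin K, Incompatible (ψ j₁) (ψ j₂)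

/-- The possible configurations `(b, x)` of the game with four boxes: the bomb is in box `b` and
the prize is in one of the other boxes, `x`. -/
abbrev Config : Type := {c : Fin 4 × Fin 4 // c.2 ≠ c.1}

/-- The free choices of Alice and Bob in the game, when a qubit `Q` is transmitted from Alice to
Bob: a shared state of systems `A`, `B` of dimensions `dA`, `dB`, for each configuration
`(b, x)` an encoding channel from `A` to `Q`, and a joint measurement of `QB` whose outcome is
the box that Bob opens. -/
structure Strategy (dA dB : ℕ) where
  /-- the shared state of `AB` -/
  state : Op (Fin dA × Fin dB)
  isDensity_state : IsDensity state
  /-- the encoding operations -/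
  enc : Config → Op (Fin dA) →ₗ[ℂ] Op (Fin 2)
  isChannel_enc : ∀ c, IsChannel (enc c)
  /-- the measurement -/
  povm : Fin 4 → Op (Fin 2 × Fin dB)
  isPOVM_povm : IsPOVM povm

namespace Strategy

variable {dA dB : ℕ}

/-- The probability `p(y|b,x) = Tr[M_y (N ∘ E_{b,x} ⊗ I)(ρ_AB)]` that Bob opens box `y` when the
configuration is `c = (b, x)` and the channel `N` is used. -/
noncomputable def prob (S : Strategy dA dB) (N : Op (Fin 2) →ₗ[ℂ] Op (Fin 2))
    (y : Fin 4) (c : Config) : ℝ :=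
  (S.povm y * onLeft (Fin dB) (N ∘ₗ S.enc c) S.state).trace.re

/-- The worst-case probability of opening the box with the bomb, `max_{b,x} p(b|b,x)`. -/
noncomputable def worstBomb (S : Strategy dA dB) (N : Op (Fin 2) →ₗ[ℂ] Op (Fin 2)) : ℝ :=
  ⨆ c : Config, S.prob N c.1.1 c

/-- The worst-case probability of finding the prize, `min_{b,x} p(x|b,x)`. -/
noncomputable def worstPrize (S : Strategy dA dB) (N : Op (Fin 2) →ₗ[ℂ] Op (Fin 2)) : ℝ :=
  ⨅ c : Config, S.prob N c.1.2 c

/-- The strategy avoids the bomb with certainty. -/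
def AvoidsBomb (S : Strategy dA dB) (N : Op (Fin 2) →ₗ[ℂ] Op (Fin 2)) : Prop :=
  S.worstBomb N = 0

end Strategy

end BombPrize

/-!
The Kraus operators `|ψ_{s+1}⟩⟨ψ_s|` of a quantum NOT channel `N` span all traceless operators, as
soon as two of the bases are incompatible: an operator orthogonal to all of them is diagonal in both
bases, hence scalar. Consequently, if a Kraus operator `K` on Bob's side comes from an effect
`M = ∑ᵢ |K̄ᵢ⟩⟨K̄ᵢ|` that has probability zero after `N` acts on `σ`, then `(1 ⊗ K) σ (1 ⊗ K)†` is
orthogonal to all traceless operators (seen as vectors of `ℂ² ⊗ ℂ²`), so it is a multiple of the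
ebit (`filtered_eq_smul_ebit`).

For a bomb-avoiding strategy this applies to `σ_{b,x}`, the state after encoding, and to the Kraus
operators of `M_b`. Since `∑_b M_b = 1`, the maps `Y ↦ ½ ∑ᵢ K_{b,i} Y K_{b,i}†` form an instrument.
Bob applies it and announces `b`, and Alice applies `E_{b,x}` for any `x ≠ b`; the result is an ebit
whatever `b` is (`loccConvertible_ebit`).

The filtered states cannot all vanish. If `B` is a qubit and the filter `K_{b,i}` gives a nonzero
result, then `K_{b,i}` is invertible, because the ebit has full Schmidt rank. Inverting it shows that
`σ_{b,x}` is the same for all `x ≠ b`, so the probabilities `p(x|b,x)` of these three `x` add up to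
one, and the smallest is at most `1/3` (`worstPrize_le`).
-/

namespace BombPrize

open Matrix
open scoped ComplexOrder Kronecker

/-! ### Local maps and complete positivity -/

/-- The completely positive map `X ↦ K X K†` with the single Kraus operator `K`. -/
noncomputable def conjMap {α α' : Type} [Fintype α] (K : Matrix α' α ℂ) : Op α →ₗ[ℂ] Op α' where
  toFun X := K * X * Kᴴ
  map_add' X Y := by rw [Matrix.mul_add, Matrix.add_mul]
  map_smul' c X := by simp

lemma conjMap_apply {α α' : Type} [Fintype α] (K : Matrix α' α ℂ) (X : Op α) :
    conjMap K X = K * X * Kᴴ := rfl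

lemma onLeft_conjMap {α α' β : Type} [Fintype α] [Fintype β] [DecidableEq β]
    (L : Matrix α' α ℂ) (X : Op (α × β)) :
    onLeft β (conjMap L) X = (L ⊗ₖ (1 : Op β)) * X * (L ⊗ₖ (1 : Op β))ᴴ := by
  ext p q
  simp [onLeft, conjMap, Matrix.mul_apply, Fintype.sum_prod_type, Matrix.one_apply,
    Finset.sum_mul, apply_ite (starRingEnd ℂ)]

lemma onRight_conjMap {α β β' : Type} [Fintype α] [DecidableEq α] [Fintype β]
    (K : Matrix β' β ℂ) (X : Op (α × β)) :
    onRight α (conjMap K) X = ((1 : Op α) ⊗ₖ K) * X * ((1 : Op α) ⊗ₖ K)ᴴ := by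
  ext p q
  simp [onRight, conjMap, Matrix.mul_apply, Fintype.sum_prod_type, Matrix.one_apply,
    Finset.sum_mul, apply_ite (starRingEnd ℂ)]

lemma onLeft_sum {α α' β ι : Type} (s : Finset ι) (Φ : ι → Op α →ₗ[ℂ] Op α') (X : Op (α × β)) :
    onLeft β (∑ i ∈ s, Φ i) X = ∑ i ∈ s, onLeft β (Φ i) X := by
  ext p q
  simp [onLeft, Matrix.sum_apply]

lemma onLeft_smul {α α' β : Type} (c : ℂ) (Φ : Op α →ₗ[ℂ] Op α') (X : Op (α × β)) :
    onLeft β (c • Φ) X = c • onLeft β Φ X := rfl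

lemma onRight_sum {α β β' ι : Type} (s : Finset ι) (Φ : ι → Op β →ₗ[ℂ] Op β') (X : Op (α × β)) :
    onRight α (∑ i ∈ s, Φ i) X = ∑ i ∈ s, onRight α (Φ i) X := by
  ext p q
  simp [onRight, Matrix.sum_apply]

lemma onRight_smul {α β β' : Type} (c : ℂ) (Φ : Op β →ₗ[ℂ] Op β') (X : Op (α × β)) :
    onRight α (c • Φ) X = c • onRight α Φ X := rfl

lemma trace_onLeft {α α' β : Type} [Fintype α] [Fintype α'] [Fintype β]
    (Φ : Op α →ₗ[ℂ] Op α') (hΦ : ∀ X, (Φ X).trace = X.trace) (X : Op (α × β)) :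
    (onLeft β Φ X).trace = X.trace := by
  have h (k : β) := hΦ (Matrix.of fun i j => X (i, k) (j, k))
  simp only [Matrix.trace, Matrix.diag, Matrix.of_apply, onLeft, LinearMap.coe_mk, AddHom.coe_mk,
    Fintype.sum_prod_type_right] at h ⊢
  exact Finset.sum_congr rfl fun k _ => h k

lemma trace_onRight_instrument {α : Type} [Fintype α] {β : Type} [Fintype β] {k : ℕ} {d : Fin k → ℕ}
    (Φ : ∀ i : Fin k, Op β →ₗ[ℂ] Op (Fin (d i)))
    (hΦ : ∀ X, ∑ i, (Φ i X).trace = X.trace) (X : Op (α × β)) :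
    ∑ i, (onRight α (Φ i) X).trace = X.trace := by
  have h (a : α) := hΦ (Matrix.of fun i j => X (a, i) (a, j))
  simp only [Matrix.trace, Matrix.diag, Matrix.of_apply, onRight, LinearMap.coe_mk, AddHom.coe_mk,
    Fintype.sum_prod_type] at h ⊢
  rw [Finset.sum_comm]
  exact Finset.sum_congr rfl fun a _ => h a

/-- Maps acting on different factors commute; stated for a map with a single Kraus operator on
the second factor. -/
lemma onLeft_onRight_conjMap {α α' β β' : Type} [Fintype β]
    (Φ : Op α →ₗ[ℂ] Op α') (K : Matrix β' β ℂ) (X : Op (α × β)) :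
    onLeft β' Φ (onRight α (conjMap K) X) = onRight α' (conjMap K) (onLeft β Φ X) := by
  ext p q
  have h : (Matrix.of fun i j => onRight α (conjMap K) X (i, p.2) (j, q.2)) =
      ∑ l, ∑ k, (K p.2 k * star (K q.2 l)) • (Matrix.of fun i j => X (i, k) (j, l)) := by
    ext i j
    simp only [onRight, conjMap, LinearMap.coe_mk, AddHom.coe_mk, Matrix.of_apply,
      Matrix.mul_apply, Matrix.sum_apply, Matrix.smul_apply, smul_eq_mul,
      Matrix.conjTranspose_apply, Finset.sum_mul]
    exact Finset.sum_congr rfl fun _ _ => Finset.sum_congr rfl fun _ _ => by ring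
  change Φ (Matrix.of fun i j => onRight α (conjMap K) X (i, p.2) (j, q.2)) p.1 q.1 = _
  rw [h]
  simp only [map_sum, map_smul, onRight, onLeft, conjMap, LinearMap.coe_mk, AddHom.coe_mk,
    Matrix.of_apply, Matrix.mul_apply, Matrix.sum_apply, Matrix.smul_apply, smul_eq_mul,
    Matrix.conjTranspose_apply, Finset.sum_mul]
  exact Finset.sum_congr rfl fun _ _ => Finset.sum_congr rfl fun _ _ => by ring

lemma isCompletelyPositive_conjMap {α α' : Type} [Fintype α] [Fintype α']
    (K : Matrix α' α ℂ) : IsCompletelyPositive (conjMap K) := by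
  intro k X hX
  rw [onLeft_conjMap]
  exact hX.mul_mul_conjTranspose_same _

lemma isCompletelyPositive_sum {α α' ι : Type} [Fintype α] [Fintype α'] (s : Finset ι)
    (Φ : ι → Op α →ₗ[ℂ] Op α') (h : ∀ i, IsCompletelyPositive (Φ i)) :
    IsCompletelyPositive (∑ i ∈ s, Φ i) := by
  intro k X hX
  rw [onLeft_sum]
  exact Matrix.posSemidef_sum s fun i _ => h i k X hX

lemma isCompletelyPositive_smul {α α' : Type} [Fintype α] [Fintype α'] {c : ℂ} (hc : 0 ≤ c)
    {Φ : Op α →ₗ[ℂ] Op α'} (h : IsCompletelyPositive Φ) : IsCompletelyPositive (c • Φ) := by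
  intro k X hX
  rw [onLeft_smul]
  exact (h k X hX).smul hc

/-! ### The Kraus operators of a quantum NOT channel -/

/-- The operator `|ψ_{s+1}⟩⟨ψ_s|`, a Kraus operator of `cqNOT ψ`. -/
noncomputable def flipOp (ψ : QubitBasis) (s : Fin 2) : Op (Fin 2) :=
  vecMulVec (ψ (s + 1)).ofLp (star (ψ s).ofLp)

lemma cqNOT_eq_sum_conjMap (ψ : QubitBasis) : cqNOT ψ = ∑ s, conjMap (flipOp ψ s) := by
  ext1 X
  simp only [cqNOT, LinearMap.coe_mk, AddHom.coe_mk, LinearMap.sum_apply, conjMap_apply, flipOp,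
    basisProj, ketBra]
  refine Finset.sum_congr rfl fun s _ => ?_
  ext i j
  simp [Matrix.mul_apply, vecMulVec_apply, dotProduct, mulVec, Fin.sum_univ_two]
  ring

lemma basis_dotProduct (ψ : QubitBasis) (s t : Fin 2) :
    star (ψ s).ofLp ⬝ᵥ (ψ t).ofLp = if s = t then 1 else 0 := by
  rw [← orthonormal_iff_ite.mp ψ.orthonormal s t, EuclideanSpace.inner_eq_star_dotProduct,
    dotProduct_comm]

lemma sum_basisProj (ψ : QubitBasis) : ∑ s, basisProj ψ s = 1 := by
  have h : ∀ v : Fin 2 → ℂ, (∑ s, basisProj ψ s) *ᵥ v = v := by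
    intro v
    have := congrArg WithLp.ofLp (ψ.sum_repr' (WithLp.toLp 2 v))
    rw [Matrix.sum_mulVec]
    simp only [basisProj, ketBra, vecMulVec_mulVec, op_smul_eq_smul]
    simpa [EuclideanSpace.inner_eq_star_dotProduct, dotProduct_comm] using this
  ext i j
  have := congrFun (h (Pi.single j 1)) i
  simpa [Matrix.one_apply, Pi.single_apply] using this

lemma trace_cqNOT (ψ : QubitBasis) (X : Op (Fin 2)) : (cqNOT ψ X).trace = X.trace := by
  have h1 (s : Fin 2) : (flipOp ψ s)ᴴ * flipOp ψ s = basisProj ψ s := by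
    rw [flipOp, conjTranspose_vecMulVec, vecMulVec_mul_vecMulVec, basis_dotProduct]
    simp [basisProj, ketBra]
  rw [cqNOT_eq_sum_conjMap, LinearMap.sum_apply, Matrix.trace_sum]
  simp only [conjMap_apply]
  have h2 (s : Fin 2) : (flipOp ψ s * X * (flipOp ψ s)ᴴ).trace = (basisProj ψ s * X).trace := by
    rw [Matrix.trace_mul_comm, ← Matrix.mul_assoc, h1]
  simp only [h2]
  rw [← Matrix.trace_sum, ← Matrix.sum_mul, sum_basisProj, Matrix.one_mul]

lemma trace_of_isQuantumNOT {N : Op (Fin 2) →ₗ[ℂ] Op (Fin 2)} (hN : IsQuantumNOT N)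
    (X : Op (Fin 2)) : (N X).trace = X.trace := by
  obtain ⟨K, q, ψ, -, hq, rfl, -⟩ := hN
  simp only [LinearMap.sum_apply, LinearMap.smul_apply, Matrix.trace_sum, Matrix.trace_smul,
    trace_cqNOT, smul_eq_mul, ← Finset.sum_mul]
  rw [← Complex.ofReal_sum, hq]
  simp

lemma isCompletelyPositive_of_isQuantumNOT {N : Op (Fin 2) →ₗ[ℂ] Op (Fin 2)}
    (hN : IsQuantumNOT N) : IsCompletelyPositive N := by
  obtain ⟨K, q, ψ, hq, -, rfl, -⟩ := hN
  refine isCompletelyPositive_sum _ _ fun j => isCompletelyPositive_smul ?_ ?_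
  · exact_mod_cast (hq j).le
  · rw [cqNOT_eq_sum_conjMap]
    exact isCompletelyPositive_sum _ _ fun s => isCompletelyPositive_conjMap _

/-! ### Rigidity: states annihilated by the flips of two incompatible bases -/

/-- An operator without off-diagonal entries in the basis `ψ` is an affine function of either
projector of `ψ`. -/
lemma eq_add_smul_basisProj (ψ : QubitBasis) (V : Op (Fin 2))
    (h : ∀ s, star (ψ s).ofLp ⬝ᵥ (V *ᵥ (ψ (s + 1)).ofLp) = 0) (s : Fin 2) :
    ∃ a b : ℂ, V = a • (1 : Op (Fin 2)) + b • basisProj ψ s := by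
  set c : Fin 2 → ℂ := fun t => star (ψ t).ofLp ⬝ᵥ (V *ᵥ (ψ t).ofLp) with hc
  have hPP (t u : Fin 2) : basisProj ψ t * V * basisProj ψ u =
      (star (ψ t).ofLp ⬝ᵥ (V *ᵥ (ψ u).ofLp)) • vecMulVec (ψ t).ofLp (star (ψ u).ofLp) := by
    ext i j
    simp [basisProj, ketBra, Matrix.mul_apply, vecMulVec_apply, dotProduct, mulVec,
      Fin.sum_univ_two]
    ring
  have h1 : basisProj ψ (s + 1) = 1 - basisProj ψ s := by
    rw [← sum_basisProj ψ, Fin.sum_univ_two]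
    fin_cases s <;> simp
  have h2 : V = c s • basisProj ψ s + c (s + 1) • basisProj ψ (s + 1) := by
    have hs : basisProj ψ s + basisProj ψ (s + 1) = 1 := by rw [h1]; abel
    have hss : s + 1 + 1 = s := by fin_cases s <;> rfl
    have h01 := h s
    have h10 := h (s + 1)
    rw [hss] at h10
    calc V = (basisProj ψ s + basisProj ψ (s + 1)) * V *
          (basisProj ψ s + basisProj ψ (s + 1)) := by rw [hs]; simp
      _ = _ := by
        simp only [Matrix.add_mul, Matrix.mul_add, hPP, h01, h10]
        simp [hc, basisProj, ketBra]
  refine ⟨c (s + 1), c s - c (s + 1), ?_⟩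
  nth_rewrite 1 [h2]
  rw [h1]
  module

lemma eq_smul_one_of_incompatible {ψ φ : QubitBasis} (hI : Incompatible ψ φ) (V : Op (Fin 2))
    (hψ : ∀ s, star (ψ s).ofLp ⬝ᵥ (V *ᵥ (ψ (s + 1)).ofLp) = 0)
    (hφ : ∀ s, star (φ s).ofLp ⬝ᵥ (V *ᵥ (φ (s + 1)).ofLp) = 0) :
    ∃ a : ℂ, V = a • (1 : Op (Fin 2)) := by
  obtain ⟨m, n, hmn⟩ := hI
  obtain ⟨a, b, hV⟩ := eq_add_smul_basisProj ψ V hψ m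
  obtain ⟨a', b', hV'⟩ := eq_add_smul_basisProj φ V hφ n
  have hc : Commute V (basisProj φ n) := by
    rw [hV']
    exact ((Commute.one_left _).smul_left _).add_left ((Commute.refl _).smul_left _)
  have hb : b = 0 := by
    by_contra hb
    apply hmn
    have hP : basisProj ψ m = b⁻¹ • (V - a • (1 : Op (Fin 2))) := by
      rw [hV]
      simp [smul_smul, hb]
    rw [hP]
    exact (hc.sub_left ((Commute.one_left _).smul_left _)).smul_left _
  exact ⟨a, by rw [hV, hb]; simp⟩

/-- The vector of `ℂ² ⊗ ℂ^β` whose coordinates are the entries of the matrix `V`. -/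
def vecOf {β : Type} (V : Matrix (Fin 2) β ℂ) : Fin 2 × β → ℂ := fun p => V p.1 p.2

lemma ebit_apply (p q : Fin 2 × Fin 2) :
    ebit p q = if p.1 = p.2 ∧ q.1 = q.2 then 1 / 2 else 0 := by
  have h : 1 / ((√2 : ℝ) : ℂ) * (1 / ((√2 : ℝ) : ℂ)) = 1 / 2 := by
    rw [one_div_mul_one_div, ← Complex.ofReal_mul, Real.mul_self_sqrt (by norm_num)]
    norm_num
  by_cases h1 : p.1 = p.2 <;> by_cases h2 : q.1 = q.2 <;>
    simp [ebit, ketBra, vecMulVec_apply, h1, h2, h, -one_div]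

/-- A two-qubit Hermitian operator annihilated by the vectors `ψ_s ⊗ ψ̄_{s+1}` and `φ_s ⊗ φ̄_{s+1}`
of two incompatible bases is a multiple of the ebit: regarded as a matrix, a column is diagonal in
both bases, hence scalar. -/
lemma eq_trace_smul_ebit {ψ φ : QubitBasis} (hI : Incompatible ψ φ) {τ : Op (Fin 2 × Fin 2)}
    (hτ : τ.IsHermitian) (hψ : ∀ s, τ *ᵥ vecOf (flipOp ψ s)ᴴ = 0)
    (hφ : ∀ s, τ *ᵥ vecOf (flipOp φ s)ᴴ = 0) : τ = τ.trace • ebit := by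
  have key (χ : QubitBasis) (h : ∀ s, τ *ᵥ vecOf (flipOp χ s)ᴴ = 0) (q : Fin 2 × Fin 2)
      (s : Fin 2) : star (χ s).ofLp ⬝ᵥ
        ((Matrix.of fun i j => τ (i, j) q : Op (Fin 2)) *ᵥ (χ (s + 1)).ofLp) = 0 := by
    have h1 := congrArg star (congrFun (h s) q)
    have h2 (p : Fin 2 × Fin 2) : (starRingEnd ℂ) (τ q p) = τ p q := hτ.apply p q
    simp only [mulVec, dotProduct, star_mul', Fintype.sum_prod_type, Fin.sum_univ_two,
      Complex.star_def, h2, vecOf, flipOp, conjTranspose_apply, vecMulVec_apply, Pi.star_apply,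
      Complex.conj_conj, map_mul, Pi.zero_apply, map_zero, map_add, Matrix.of_apply] at h1 ⊢
    linear_combination h1
  choose a ha using fun q => eq_smul_one_of_incompatible hI _ (key ψ hψ q) (key φ hφ q)
  have hcol (i j : Fin 2) (q : Fin 2 × Fin 2) : τ (i, j) q = if i = j then a q else 0 := by
    have := congrFun (congrFun (ha q) i) j
    simpa [Matrix.one_apply] using this
  have hrow (p q : Fin 2 × Fin 2) : τ p q = if p.1 = p.2 ∧ q.1 = q.2 then a (0, 0) else 0 := by
    have e1 (k l : Fin 2) : a (k, l) = if k = l then star (a (0, 0)) else 0 := by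
      have h3 := hτ.apply (0, 0) (k, l)
      rw [hcol, hcol] at h3
      rw [if_pos rfl] at h3
      rw [← h3]
      split_ifs <;> simp
    have e2 : star (a (0, 0)) = a (0, 0) := by simpa using (e1 0 0).symm
    obtain ⟨i, j⟩ := p
    obtain ⟨k, l⟩ := q
    rw [hcol, e1, e2]
    by_cases h1 : i = j <;> by_cases h2 : k = l <;> simp [h1, h2]
  have htr : τ.trace = 2 * a (0, 0) := by
    simp [Matrix.trace, Fintype.sum_prod_type, hrow]
  ext p q
  rw [htr, Matrix.smul_apply, ebit_apply, hrow]
  split_ifs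
  · rw [smul_eq_mul]
    ring
  · rw [smul_zero]

/-! ### Outcomes of probability zero after a NOT channel -/

/-- The entries of `K̄` form the vector `(1 ⊗ K†)` applied to `∑ᵢ |i⟩|i⟩`, and a Kraus operator of
the channel commutes past `1 ⊗ K†`. So the expectation on `K̄` after the channel is the sum of the
expectations of `(1 ⊗ K) σ (1 ⊗ K)†` on the vectors of the flips. -/
lemma dotProduct_onLeft_cqNOT {β : Type} [Fintype β] [DecidableEq β] (ψ : QubitBasis)
    (σ : Op (Fin 2 × β)) (K : Matrix (Fin 2) β ℂ) :
    star (star (vecOf K)) ⬝ᵥ (onLeft β (cqNOT ψ) σ *ᵥ star (vecOf K)) =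
      ∑ s, star (vecOf (flipOp ψ s)ᴴ) ⬝ᵥ
        (onRight (Fin 2) (conjMap K) σ *ᵥ vecOf (flipOp ψ s)ᴴ) := by
  rw [cqNOT_eq_sum_conjMap, onLeft_sum, Matrix.sum_mulVec, dotProduct_sum]
  refine Finset.sum_congr rfl fun s _ => ?_
  have h {γ : Type} [Fintype γ] (A : Matrix γ (Fin 2 × β) ℂ) (v : γ → ℂ) :
      star v ⬝ᵥ ((A * σ * Aᴴ) *ᵥ v) = star (Aᴴ *ᵥ v) ⬝ᵥ (σ *ᵥ (Aᴴ *ᵥ v)) := by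
    rw [star_mulVec, conjTranspose_conjTranspose, ← mulVec_mulVec, ← mulVec_mulVec,
      dotProduct_mulVec]
  have hv : (flipOp ψ s ⊗ₖ (1 : Op β))ᴴ *ᵥ star (vecOf K) =
      ((1 : Op (Fin 2)) ⊗ₖ K)ᴴ *ᵥ vecOf (flipOp ψ s)ᴴ := by
    ext ⟨i, k⟩
    simp [mulVec, dotProduct, Fintype.sum_prod_type, vecOf, Matrix.one_apply,
      apply_ite (starRingEnd ℂ), mul_comm]
  rw [onLeft_conjMap, onRight_conjMap, h, h, hv]

open scoped MatrixOrder Matrix.Norms.L2Operator in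
/-- A Kraus decomposition of an effect: `Tr[M X]` is the sum of the expectations of `X` on the
conjugated rows of a square root of `M`. -/
lemma exists_kraus {β : Type} [Fintype β] [DecidableEq β] {M : Op (Fin 2 × β)}
    (hM : M.PosSemidef) : ∃ K : Fin 2 × β → Matrix (Fin 2) β ℂ,
      M = ∑ i, vecMulVec (star (vecOf (K i))) (vecOf (K i)) := by
  obtain ⟨B, rfl⟩ := CStarAlgebra.nonneg_iff_eq_star_mul_self.mp hM.nonneg
  refine ⟨fun i => Matrix.of fun j k => B i (j, k), ?_⟩
  ext p q
  simp [star_eq_conjTranspose, Matrix.mul_apply, Matrix.sum_apply, vecMulVec_apply, vecOf]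

lemma trace_rankOne_mul {α : Type} [Fintype α] (u v : α → ℂ) (X : Op α) :
    (vecMulVec u v * X).trace = v ⬝ᵥ (X *ᵥ u) := by
  rw [vecMulVec_mul, trace_vecMulVec, dotProduct_mulVec, dotProduct_comm]

lemma trace_effect_mul_nonneg {β : Type} [Fintype β] [DecidableEq β] {M X : Op (Fin 2 × β)}
    (hM : M.PosSemidef) (hX : X.PosSemidef) : 0 ≤ (M * X).trace := by
  obtain ⟨K, rfl⟩ := exists_kraus hM
  rw [Matrix.sum_mul, Matrix.trace_sum]
  refine Finset.sum_nonneg fun i _ => ?_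
  rw [trace_rankOne_mul]
  have := hX.dotProduct_mulVec_nonneg (star (vecOf (K i)))
  rwa [star_star] at this

/-- If the outcome `M = ∑ᵢ |K̄ᵢ⟩⟨K̄ᵢ|` has probability zero after a quantum NOT channel, every
Kraus operator `Kᵢ` on Bob's side filters the state before the channel into an (unnormalized)
ebit. -/
lemma filtered_eq_smul_ebit {N : Op (Fin 2) →ₗ[ℂ] Op (Fin 2)} (hN : IsQuantumNOT N)
    {β : Type} [Fintype β] [DecidableEq β] {σ : Op (Fin 2 × β)} (hσ : σ.PosSemidef)
    {ι : Type} [Fintype ι] (K : ι → Matrix (Fin 2) β ℂ)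
    (h : (((∑ i, vecMulVec (star (vecOf (K i))) (vecOf (K i))) * onLeft β N σ).trace) = 0)
    (i : ι) :
    onRight (Fin 2) (conjMap (K i)) σ =
      (onRight (Fin 2) (conjMap (K i)) σ).trace • ebit := by
  obtain ⟨n, q, ψ, hq, -, rfl, j₁, j₂, hI⟩ := hN
  have hpos (i : ι) : (onRight (Fin 2) (conjMap (K i)) σ).PosSemidef := by
    rw [onRight_conjMap]
    exact hσ.mul_mul_conjTranspose_same _
  set f : ι → Fin n → Fin 2 → ℂ := fun i j s => star (vecOf (flipOp (ψ j) s)ᴴ) ⬝ᵥ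
        (onRight (Fin 2) (conjMap (K i)) σ *ᵥ vecOf (flipOp (ψ j) s)ᴴ) with hf
  have hf0 (i j s) : 0 ≤ f i j s := (hpos i).dotProduct_mulVec_nonneg _
  have hsum : ((∑ i, vecMulVec (star (vecOf (K i))) (vecOf (K i))) *
      onLeft β (∑ j, (q j : ℂ) • cqNOT (ψ j)) σ).trace = ∑ i, ∑ j, ∑ s, (q j : ℂ) * f i j s := by
    rw [Matrix.sum_mul, Matrix.trace_sum]
    refine Finset.sum_congr rfl fun i _ => ?_
    rw [trace_rankOne_mul, onLeft_sum, Matrix.sum_mulVec, dotProduct_sum]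
    refine Finset.sum_congr rfl fun j _ => ?_
    rw [onLeft_smul, Matrix.smul_mulVec, dotProduct_smul, smul_eq_mul, ← Finset.mul_sum]
    have := dotProduct_onLeft_cqNOT (ψ j) σ (K i)
    rw [star_star] at this
    rw [this]
  have hq0 (j) : (0 : ℂ) < (q j : ℂ) := by exact_mod_cast hq j
  have ht (i j s) : 0 ≤ (q j : ℂ) * f i j s := mul_nonneg (hq0 j).le (hf0 i j s)
  have hz := hsum.symm.trans h
  have hfz (j s) : f i j s = 0 := by
    rw [Finset.sum_eq_zero_iff_of_nonneg fun i _ => Finset.sum_nonneg fun j _ =>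
      Finset.sum_nonneg fun s _ => ht i j s] at hz
    have hz1 := hz i (Finset.mem_univ _)
    rw [Finset.sum_eq_zero_iff_of_nonneg fun j _ => Finset.sum_nonneg fun s _ => ht i j s] at hz1
    have hz2 := hz1 j (Finset.mem_univ _)
    rw [Finset.sum_eq_zero_iff_of_nonneg fun s _ => ht i j s] at hz2
    exact (mul_eq_zero.mp (hz2 s (Finset.mem_univ _))).resolve_left (hq0 j).ne'
  exact eq_trace_smul_ebit hI (hpos i).isHermitian
    (fun s => ((hpos i).dotProduct_mulVec_zero_iff _).mp (hfz j₁ s))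
    (fun s => ((hpos i).dotProduct_mulVec_zero_iff _).mp (hfz j₂ s))

/-- A filter that produces a nonzero multiple of the ebit from two qubits is invertible, because
the ebit has Schmidt rank two. -/
lemma det_ne_zero_of_filtered {K : Op (Fin 2)} {σ : Op (Fin 2 × Fin 2)} {c : ℂ} (hc : c ≠ 0)
    (h : onRight (Fin 2) (conjMap K) σ = c • ebit) : K.det ≠ 0 := by
  intro hdet
  obtain ⟨u, hu, huK⟩ := Matrix.exists_vecMul_eq_zero_iff.mpr hdet
  apply hu
  ext i
  have h1 : ∑ j, u j * onRight (Fin 2) (conjMap K) σ (i, j) (0, 0) = 0 := by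
    have h2 : u ᵥ* (K * (Matrix.of fun k l => σ (i, k) (0, l)) * Kᴴ) = 0 := by
      rw [← vecMul_vecMul, ← vecMul_vecMul, huK, zero_vecMul, zero_vecMul]
    exact congrFun h2 0
  simpa [h, ebit_apply, hc] using h1

/-- For a fixed invertible filter that turns it into a multiple of the ebit, a normalized
two-qubit operator is unique. -/
lemma eq_of_filtered {K : Op (Fin 2)} (hK : K.det ≠ 0) {σ σ' : Op (Fin 2 × Fin 2)} {c c' : ℂ}
    (h : onRight (Fin 2) (conjMap K) σ = c • ebit) (h' : onRight (Fin 2) (conjMap K) σ' = c' • ebit)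
    (hσ : σ.trace = 1) (hσ' : σ'.trace = 1) : σ = σ' := by
  set ω := onRight (Fin 2) (conjMap K⁻¹) ebit with hω
  have hKK : K⁻¹ * K = 1 := Matrix.nonsing_inv_mul _ (Ne.isUnit hK)
  have hinv (X : Op (Fin 2 × Fin 2)) :
      onRight (Fin 2) (conjMap K⁻¹) (onRight (Fin 2) (conjMap K) X) = X := by
    have h1 : (1 : Op (Fin 2)) ⊗ₖ K⁻¹ * (1 : Op (Fin 2)) ⊗ₖ K = 1 := by
      rw [← Matrix.mul_kronecker_mul, hKK, Matrix.one_mul, Matrix.one_kronecker_one]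
    rw [onRight_conjMap, onRight_conjMap]
    calc _ = ((1 : Op (Fin 2)) ⊗ₖ K⁻¹ * (1 : Op (Fin 2)) ⊗ₖ K) * X *
          ((1 : Op (Fin 2)) ⊗ₖ K⁻¹ * (1 : Op (Fin 2)) ⊗ₖ K)ᴴ := by
            rw [conjTranspose_mul]; simp only [Matrix.mul_assoc]
      _ = X := by rw [h1]; simp
  have e : σ = c • ω := by rw [← hinv σ, h, map_smul]
  have e' : σ' = c' • ω := by rw [← hinv σ', h', map_smul]
  have t : c * ω.trace = 1 := by rw [← hσ, e, Matrix.trace_smul, smul_eq_mul]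
  have t' : c' * ω.trace = 1 := by rw [← hσ', e', Matrix.trace_smul, smul_eq_mul]
  have hω0 : ω.trace ≠ 0 := right_ne_zero_of_mul_eq_one t
  rw [e, e', mul_right_cancel₀ hω0 (t.trans t'.symm)]

/-! ### Bomb-avoiding strategies -/

namespace Strategy

variable {dA dB : ℕ}

/-- The state of the transmitted qubit and Bob's system just before the channel acts. -/
noncomputable def encoded (S : Strategy dA dB) (c : Config) : Op (Fin 2 × Fin dB) :=
  onLeft (Fin dB) (S.enc c) S.state

lemma posSemidef_encoded (S : Strategy dA dB) (c : Config) : (S.encoded c).PosSemidef :=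
  (S.isChannel_enc c).1 dB _ S.isDensity_state.1

lemma trace_encoded (S : Strategy dA dB) (c : Config) : (S.encoded c).trace = 1 := by
  rw [encoded, trace_onLeft _ (S.isChannel_enc c).2, S.isDensity_state.2]

/-- The worst-case probability is a maximum of nonnegative numbers, so each of them vanishes. -/
lemma trace_bomb_eq_zero {N : Op (Fin 2) →ₗ[ℂ] Op (Fin 2)} (hN : IsQuantumNOT N)
    {S : Strategy dA dB} (h : S.AvoidsBomb N) (c : Config) :
    (S.povm c.1.1 * onLeft (Fin dB) N (S.encoded c)).trace = 0 := by
  have h1 : S.prob N c.1.1 c ≤ 0 := (le_ciSup (f := fun c : Config => S.prob N c.1.1 c)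
    (Set.finite_range _).bddAbove c).trans h.le
  have h2 := trace_effect_mul_nonneg (S.isPOVM_povm.1 c.1.1)
    (isCompletelyPositive_of_isQuantumNOT hN _ _ (S.posSemidef_encoded c))
  rw [Complex.le_def] at h2
  exact Complex.ext (le_antisymm h1 h2.1) h2.2.symm

lemma exists_povm_kraus (S : Strategy dA dB) :
    ∃ K : Fin 4 → Fin 2 × Fin dB → Matrix (Fin 2) (Fin dB) ℂ,
      ∀ y, S.povm y = ∑ i, vecMulVec (star (vecOf (K y i))) (vecOf (K y i)) :=
  ⟨fun y => (exists_kraus (S.isPOVM_povm.1 y)).choose,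
    fun y => (exists_kraus (S.isPOVM_povm.1 y)).choose_spec⟩

/-- The map `Y ↦ ½ ∑ᵢ Kᵢ Y Kᵢ†`. When the `Kᵢ` come from an effect `M` on `Q ⊗ B`, the operator
`½ Mᵀ` is its Choi operator; the factor `½` compensates for the trace of the identity on `Q`. -/
noncomputable def bobMap {ι : Type} [Fintype ι] (K : ι → Matrix (Fin 2) (Fin dB) ℂ) :
    Op (Fin dB) →ₗ[ℂ] Op (Fin 2) := (1 / 2 : ℂ) • ∑ i, conjMap (K i)

/-- The POVM elements sum to the identity, so the maps `bobMap` sum to a trace-preserving map. -/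
lemma isInstrument_bobMap (S : Strategy dA dB)
    (K : Fin 4 → Fin 2 × Fin dB → Matrix (Fin 2) (Fin dB) ℂ)
    (hK : ∀ y, S.povm y = ∑ i, vecMulVec (star (vecOf (K y i))) (vecOf (K y i))) :
    IsInstrument (d := fun _ => 2) fun y => bobMap (K y) := by
  refine ⟨fun y => isCompletelyPositive_smul (by norm_num [Complex.le_def])
    (isCompletelyPositive_sum _ _ fun i => isCompletelyPositive_conjMap _), fun X => ?_⟩
  have hKK : ∑ y, ∑ i, (K y i)ᴴ * K y i = (2 : ℂ) • (1 : Op (Fin dB)) := by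
    ext k l
    have h (j : Fin 2) := congrFun (congrFun S.isPOVM_povm.2 (j, k)) (j, l)
    simp only [hK, Matrix.sum_apply, vecMulVec_apply, vecOf, Pi.star_apply] at h
    simp only [Matrix.sum_apply, Matrix.mul_apply, conjTranspose_apply, Fin.sum_univ_two,
      Finset.sum_add_distrib]
    have h0 := h 0
    have h1 := h 1
    simp only [Matrix.one_apply, Prod.mk.injEq, true_and, Matrix.smul_apply, smul_eq_mul] at *
    linear_combination h0 + h1
  have htr (y) : (bobMap (K y) X).trace = (1 / 2 : ℂ) * ((∑ i, (K y i)ᴴ * K y i) * X).trace := by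
    simp only [bobMap, LinearMap.smul_apply, LinearMap.sum_apply, Matrix.trace_smul,
      Matrix.trace_sum, conjMap_apply, Matrix.sum_mul, smul_eq_mul]
    congr 1
    refine Finset.sum_congr rfl fun i _ => ?_
    rw [Matrix.trace_mul_comm, ← Matrix.mul_assoc]
  simp only [htr]
  rw [← Finset.mul_sum, ← Matrix.trace_sum, ← Matrix.sum_mul, hKK]
  simp

lemma filtered_encoded {N : Op (Fin 2) →ₗ[ℂ] Op (Fin 2)} (hN : IsQuantumNOT N)
    {S : Strategy dA dB} (hS : S.AvoidsBomb N)
    {K : Fin 4 → Fin 2 × Fin dB → Matrix (Fin 2) (Fin dB) ℂ}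
    (hK : ∀ y, S.povm y = ∑ i, vecMulVec (star (vecOf (K y i))) (vecOf (K y i)))
    (c : Config) (i : Fin 2 × Fin dB) :
    onRight (Fin 2) (conjMap (K c.1.1 i)) (S.encoded c) =
      (onRight (Fin 2) (conjMap (K c.1.1 i)) (S.encoded c)).trace • ebit := by
  have h := trace_bomb_eq_zero hN hS c
  rw [hK] at h
  exact filtered_eq_smul_ebit hN (S.posSemidef_encoded c) _ h i

/-- A configuration with the bomb in a given box. -/
def bombAt (b : Fin 4) : Config := ⟨(b, b + 1), by revert b; decide⟩

lemma onLeft_onRight_bobMap {ι : Type} [Fintype ι] (K : ι → Matrix (Fin 2) (Fin dB) ℂ)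
    (Φ : Op (Fin dA) →ₗ[ℂ] Op (Fin 2)) (X : Op (Fin dA × Fin dB)) :
    onLeft (Fin 2) Φ (onRight (Fin dA) (bobMap K) X) =
      (1 / 2 : ℂ) • ∑ i, onRight (Fin 2) (conjMap (K i)) (onLeft (Fin dB) Φ X) := by
  simp only [bobMap, onRight_smul, onRight_sum, map_smul, map_sum, onLeft_onRight_conjMap]

/-- Bob performs the instrument `bobMap` and announces its outcome `b`; Alice encodes as in a
configuration with the bomb in box `b`. For every outcome the result is an ebit. -/
lemma loccConvertible_ebit {N : Op (Fin 2) →ₗ[ℂ] Op (Fin 2)} (hN : IsQuantumNOT N)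
    {S : Strategy dA dB} (hS : S.AvoidsBomb N) : LOCCConvertible S.state ebit := by
  obtain ⟨K, hK⟩ := S.exists_povm_kraus
  have hI := S.isInstrument_bobMap K hK
  refine ⟨_, IsLOCC.bob (fun y => bobMap (K y)) hI
    (fun y => ∑ _i : Fin 1, LinearMap.id ∘ₗ onLeft (Fin 2) (S.enc (bombAt y)))
    (fun y => IsLOCC.alice (d := fun _ => 2) (fun _ => S.enc (bombAt y))
      ⟨fun _ => (S.isChannel_enc _).1, fun X => by simp [(S.isChannel_enc _).2]⟩
      (fun _ => LinearMap.id) fun _ => IsLOCC.halt), ?_⟩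
  simp only [LinearMap.sum_apply, LinearMap.comp_apply, Finset.univ_unique, Finset.sum_singleton,
    LinearMap.id_apply]
  have h1 (y : Fin 4) :
      onLeft (Fin 2) (S.enc (bombAt y)) (onRight (Fin dA) (bobMap (K y)) S.state) =
      (onRight (Fin dA) (bobMap (K y)) S.state).trace • ebit := by
    rw [← trace_onLeft (S.enc (bombAt y)) (S.isChannel_enc _).2, onLeft_onRight_bobMap]
    rw [Matrix.trace_smul, Matrix.trace_sum, smul_assoc, Finset.sum_smul]
    congr 1
    exact Finset.sum_congr rfl fun i _ => filtered_encoded hN hS hK (bombAt y) i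
  simp only [h1]
  rw [← Finset.sum_smul, trace_onRight_instrument _ hI.2, S.isDensity_state.2, one_smul]

/-- The local filters cannot all fail. -/
lemma exists_filtered_ne_zero (S : Strategy dA dB)
    {K : Fin 4 → Fin 2 × Fin dB → Matrix (Fin 2) (Fin dB) ℂ}
    (hK : ∀ y, S.povm y = ∑ i, vecMulVec (star (vecOf (K y i))) (vecOf (K y i))) :
    ∃ b i, onRight (Fin 2) (conjMap (K b i)) (S.encoded (bombAt b)) ≠ 0 := by
  by_contra! h
  have h1 := trace_onRight_instrument _ (S.isInstrument_bobMap K hK).2 S.state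
  have h2 (y : Fin 4) : (onRight (Fin dA) (bobMap (K y)) S.state).trace = 0 := by
    rw [← trace_onLeft (S.enc (bombAt y)) (S.isChannel_enc _).2, onLeft_onRight_bobMap]
    have h3 (i : Fin 2 × Fin dB) : onRight (Fin 2) (conjMap (K y i))
        (onLeft (Fin dB) (S.enc (bombAt y)) S.state) = 0 := h y i
    simp [h3]
  rw [S.isDensity_state.2] at h1
  simp [h2] at h1

/-- With qubits on both sides, some bomb position `b` forces the encoded state to be independent
of the position of the prize, so the three other boxes share the total probability. -/
lemma worstPrize_le {N : Op (Fin 2) →ₗ[ℂ] Op (Fin 2)} (hN : IsQuantumNOT N)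
    {S : Strategy 2 2} (hS : S.AvoidsBomb N) : S.worstPrize N ≤ 1 / 3 := by
  obtain ⟨K, hK⟩ := S.exists_povm_kraus
  obtain ⟨b, i, hbi⟩ := S.exists_filtered_ne_zero hK
  have hf (c : Config) (hc : c.1.1 = b) : onRight (Fin 2) (conjMap (K b i)) (S.encoded c) =
      (onRight (Fin 2) (conjMap (K b i)) (S.encoded c)).trace • ebit := by
    subst hc
    exact filtered_encoded hN hS hK c i
  have hf0 := hf (bombAt b) rfl
  have hdet : (K b i).det ≠ 0 := by
    refine det_ne_zero_of_filtered (fun h0 => hbi ?_) hf0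
    rw [hf0, h0, zero_smul]
  have hσ (c : Config) (hc : c.1.1 = b) : S.encoded c = S.encoded (bombAt b) :=
    eq_of_filtered hdet (hf c hc) hf0 (S.trace_encoded _) (S.trace_encoded _)
  have hle (c : Config) : S.worstPrize N ≤ S.prob N c.1.2 c :=
    ciInf_le (f := fun c : Config => S.prob N c.1.2 c) (Set.finite_range _).bddBelow c
  set p : Fin 4 → ℝ := fun y => (S.povm y * onLeft (Fin 2) N (S.encoded (bombAt b))).trace.re
    with hp
  have hw (x : Fin 4) (hx : x ≠ b) : S.worstPrize N ≤ p x := by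
    have h := hle ⟨(b, x), hx⟩
    change _ ≤ (S.povm x * onLeft (Fin 2) N (S.encoded ⟨(b, x), hx⟩)).trace.re at h
    rwa [hσ _ rfl] at h
  have hb : p b = 0 := congrArg Complex.re (trace_bomb_eq_zero hN hS (bombAt b))
  have htotal : ∑ y, p y = 1 := by
    rw [hp, ← Complex.re_sum, ← Matrix.trace_sum, ← Matrix.sum_mul, S.isPOVM_povm.2,
      Matrix.one_mul, trace_onLeft _ (trace_of_isQuantumNOT hN), S.trace_encoded, Complex.one_re]
  have h3 : 3 • S.worstPrize N ≤ ∑ y ∈ Finset.univ.erase b, p y := by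
    have := Finset.card_nsmul_le_sum (Finset.univ.erase b) p (S.worstPrize N)
      fun x hx => hw x (Finset.ne_of_mem_erase hx)
    simpa using this
  rw [← Finset.add_sum_erase _ _ (Finset.mem_univ b)] at htotal
  rw [nsmul_eq_mul] at h3
  push_cast at h3
  linarith

end Strategy

end BombPrize

theorem theorem4 :
    (∀ (N : BombPrize.Op (Fin 2) →ₗ[ℂ] BombPrize.Op (Fin 2)), BombPrize.IsQuantumNOT N →
      ∀ (dA dB : ℕ) (S : BombPrize.Strategy dA dB), S.AvoidsBomb N →
        BombPrize.LOCCConvertible S.state BombPrize.ebit) ∧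
    (∀ (N : BombPrize.Op (Fin 2) →ₗ[ℂ] BombPrize.Op (Fin 2)), BombPrize.IsQuantumNOT N →
      ∀ S : BombPrize.Strategy 2 2, S.AvoidsBomb N → S.worstPrize N ≤ 1 / 3) :=
  ⟨fun _ hN _ _ _ hS => BombPrize.Strategy.loccConvertible_ebit hN hS,
    fun _ hN _ hS => BombPrize.Strategy.worstPrize_le hN hS⟩
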